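/- Let $k\ge 2$ be an integer. Define polynomials $F_i$ by $F_0(x)=1$, $F_1(x)=x$, $F_2(x)=x^2-k$ and $F_i(x)=xF_{i-1}(x)-(k-1)F_{i-2}(x)$ for $i\ge 3$, and put $G_i(x)=\sum_{j=0}^{\lfloor i/2\rfloor}F_{i-2j}(x)$ for $i\ge 0$. For $j\ge 1$ let $\lambda^{(j)}$ be the largest real zero of $G_j$ (which exists). For real $\theta$ let $b(k,\theta)$ be the maximum order of a finite connected bipartite $k$-regular simple graph $\Gamma$ with $\lambda_2(\Gamma)\le\theta$, where $\lambda_2(\Gamma)$ is the second largest eigenvalue, counted with multiplicity, of the adjacency matrix of $\Gamma$. Then \[ \bigcup_{j=1}^{\infty}\bigl(\lambda^{(j)},\lambda^{(j+1)}\bigr]=\bigl(0,2\sqrt{k-1}\bigr). \] Moreover, if $t\ge 4$ is an integer and $\theta$ is a real number with $\lambda^{(t-3)}<\theta\le\lambda^{(t-2)}$, then $G_{t-4}(\theta)\neq 0$, the number $c=-F_{t-2}(\theta)/G_{t-4}(\theta)$ is positive, the maximum defining $b(k,\theta)$ exists, and \[ b(k,\theta)\le M(k,t,c)=2\left(\sum_{i=0}^{t-4}(k-1)^i+\frac{(k-1)^{t-3}}{c}+\frac{(k-1)^{t-2}}{c}\right).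 \] -/

import Mathlib

open Polynomial

namespace BipReg

/-- The polynomials `F_i = F_i^{(k)}`: `F_0 = 1`, `F_1 = x`, `F_2 = x^2 - k` and
`F_i = x F_{i-1} - (k-1) F_{i-2}` for `i ≥ 3`. -/
noncomputable def F (k : ℕ) : ℕ → ℝ[X]
  | 0 => 1
  | 1 => X
  | 2 => X ^ 2 - C (k : ℝ)
  | (i + 3) => X * F k (i + 2) - C ((k : ℝ) - 1) * F k (i + 1)

/-- The polynomials `G_i = F_i + F_{i-2} + F_{i-4} + ⋯ = ∑_{j=0}^{⌊i/2⌋} F_{i-2j}`. -/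
noncomputable def G (k i : ℕ) : ℝ[X] :=
  ∑ j ∈ Finset.range (i / 2 + 1), F k (i - 2 * j)

/-- The largest real zero `λ^{(j)}` of `G_j`. -/
noncomputable def lam (k j : ℕ) : ℝ :=
  sSup {x : ℝ | (G k j).eval x = 0}

open Classical in
/-- The second largest eigenvalue (counted with multiplicity) of the adjacency matrix of a finite
graph with at least two vertices. `eigenvalues₀` lists all the eigenvalues with multiplicity in
decreasing order, starting at index `0`. -/
noncomputable def secondEigenvalue {V : Type*} [Fintype V] (Γ : SimpleGraph V)
    (hV : 1 < Fintype.card V) : ℝ :=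
  (Γ.isHermitian_adjMatrix ℝ).eigenvalues₀ ⟨1, hV⟩

open Classical in
/-- The orders of the connected bipartite `k`-regular graphs `Γ` with `λ₂(Γ) ≤ θ`. -/
def orders (k : ℕ) (θ : ℝ) : Set ℕ :=
  {n | ∃ (Γ : SimpleGraph (Fin n)) (hn : 1 < Fintype.card (Fin n)),
    Γ.Connected ∧ Γ.IsBipartite ∧ Γ.IsRegularOfDegree k ∧ secondEigenvalue Γ hn ≤ θ}

/-- The maximum order `b(k, θ)` of a connected bipartite `k`-regular graph `Γ` with
`λ₂(Γ) ≤ θ`. -/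
noncomputable def b (k : ℕ) (θ : ℝ) : ℕ := sSup (orders k θ)

/-- `M(k,t,c) = 2 (∑_{i=0}^{t-4} (k-1)^i + (k-1)^{t-3}/c + (k-1)^{t-2}/c)`, for `t ≥ 4`. -/
noncomputable def M (k t : ℕ) (c : ℝ) : ℝ :=
  2 * (∑ i ∈ Finset.range (t - 3), ((k : ℝ) - 1) ^ i
    + ((k : ℝ) - 1) ^ (t - 3) / c + ((k : ℝ) - 1) ^ (t - 2) / c)

/-- The parameter `c = -F_{t-2}(θ) / G_{t-4}(θ)`, for `t ≥ 4`. -/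
noncomputable def cParam (k t : ℕ) (θ : ℝ) : ℝ :=
  -(F k (t - 2)).eval θ / (G k (t - 4)).eval θ

end BipReg

namespace BipReg

/-! Write q = k - 1. From the start the `G i` satisfy the Chebyshev recurrence, so G_j(2√q cos φ)
sin φ = q^{j/2} sin((j+1)φ), and the largest zero of G_j is 2√q cos(π/(j+1)). These zeros increase
from 0 to 2√q, which gives the union of intervals and the signs of the `G i` at θ.

The bound on the order is a linear programming bound. With s = t - 4, g = G_s(θ) > 0 and d =
-F_{s+2}(θ) = g - G_{s+2}(θ) > 0, put P = g F_{s+2} + d G_s. By a Christoffel–Darboux identity P =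
(x² - θ²)K, where K is a positive combination of G_s, G_{s-2}, …. Estimate the trace of (PK)(A), for
A the adjacency matrix, in two ways. The function PK = (x² - θ²)K² is even and nonpositive on [-θ,
θ], and a bipartite spectrum is symmetric, so only ±k can contribute positively and the trace is at
most 2P(k)K(k). Conversely, the entries of F_i(A) count non-backtracking walks, so they are natural
numbers, and the trace is at least d n K(k), n being the order. Cancelling K(k) > 0 gives d n ≤
2P(k), which is the claim (`card_mul_sub_le`). The maximum exists because the orders are bounded and
K_{k,k} supplies one. -/

/-! ### Recurrence, parity and values at k of the polynomials -/

lemma G_zero (k : ℕ) : G k 0 = 1 := by simp [G, F]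

lemma G_one (k : ℕ) : G k 1 = X := by simp [G, F]

lemma G_add_two (k i : ℕ) : G k (i + 2) = F k (i + 2) + G k i := by
  have h : (i + 2) / 2 + 1 = (i / 2 + 1) + 1 := by omega
  rw [G, h, Finset.sum_range_succ', add_comm, G]
  congr 1
  refine Finset.sum_congr rfl fun j _ => ?_
  congr 1
  omega

/-- The polynomials `G_i` satisfy the Chebyshev recurrence from the start. -/
lemma G_rec (k : ℕ) : ∀ i, G k (i + 2) = X * G k (i + 1) - C ((k : ℝ) - 1) * G k i
  | 0 => by
    rw [G_add_two, G_zero, zero_add, G_one, F, C_sub, C_1]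
    ring
  | 1 => by
    rw [show 1 + 2 = 3 from rfl, show 1 + 1 = 2 from rfl, G_add_two k 1, G_add_two k 0, G_one,
      G_zero]
    simp only [F, C_sub, C_1]
    ring
  | i + 2 => by
    have hF : F k (i + 2 + 2) = X * F k (i + 1 + 2) - C ((k : ℝ) - 1) * F k (i + 2) := rfl
    linear_combination G_add_two k (i + 2) + hF - X * G_add_two k (i + 1)
      + C ((k : ℝ) - 1) * G_add_two k i + G_rec k i

lemma G_eval_rec (k i : ℕ) (x : ℝ) :
    (G k (i + 2)).eval x = x * (G k (i + 1)).eval x - ((k : ℝ) - 1) * (G k i).eval x := by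
  rw [G_rec]; simp

lemma G_eval_neg (k : ℕ) (x : ℝ) : ∀ i, (G k i).eval (-x) = (-1) ^ i * (G k i).eval x
  | 0 => by simp [G_zero]
  | 1 => by simp [G_one]
  | i + 2 => by
    rw [G_eval_rec, G_eval_rec, G_eval_neg k x (i + 1), G_eval_neg k x i]
    ring

lemma F_eval_degree (k : ℕ) (i : ℕ) :
    (F k (i + 1)).eval (k : ℝ) = (k : ℝ) * ((k : ℝ) - 1) ^ i := by
  induction i using Nat.twoStepInduction with
  | zero => simp [F]
  | one => simp [F]; ring
  | more i h1 h2 =>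
    rw [show F k (i + 2 + 1) = X * F k (i + 1 + 1) - C ((k : ℝ) - 1) * F k (i + 1) from rfl]
    simp only [eval_sub, eval_mul, eval_X, eval_C, h1, h2]
    ring

lemma G_eval_degree (k : ℕ) (i : ℕ) :
    (G k i).eval (k : ℝ) = ∑ j ∈ Finset.range (i + 1), ((k : ℝ) - 1) ^ j := by
  induction i using Nat.twoStepInduction with
  | zero => simp [G_zero]
  | one => simp [G_one, Finset.sum_range_succ]
  | more i h1 h2 =>
    rw [G_add_two, eval_add, F_eval_degree, h1, Finset.sum_range_succ _ (i + 2),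
      Finset.sum_range_succ _ (i + 1)]
    ring

/-! ### Trigonometric form and largest zeros -/

lemma G_eval_cos {k : ℕ} (hk : 2 ≤ k) (φ : ℝ) (j : ℕ) :
    (G k j).eval (2 * √((k : ℝ) - 1) * Real.cos φ) * Real.sin φ =
      √((k : ℝ) - 1) ^ j * Real.sin ((j + 1) * φ) := by
  have hq : √((k : ℝ) - 1) ^ 2 = (k : ℝ) - 1 :=
    Real.sq_sqrt (by have : (2 : ℝ) ≤ k := by exact_mod_cast hk
                     linarith)
  induction j using Nat.twoStepInduction with
  | zero => simp [G_zero]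
  | one =>
    simp only [G_one, eval_X]
    have : ((1 : ℕ) + 1 : ℝ) * φ = 2 * φ := by norm_num
    rw [this, Real.sin_two_mul]; ring
  | more j h1 h2 =>
    rw [G_eval_rec, sub_mul, mul_assoc (2 * √((k : ℝ) - 1) * Real.cos φ), h2,
      mul_assoc ((k : ℝ) - 1), h1]
    have e1 : (((j + 2 : ℕ) : ℝ) + 1) * φ = ((j + 1 : ℕ) + 1 : ℝ) * φ + φ := by push_cast; ring
    have e2 : ((j : ℝ) + 1) * φ = ((j + 1 : ℕ) + 1 : ℝ) * φ - φ := by push_cast; ring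
    rw [e1, e2, Real.sin_add, Real.sin_sub]
    linear_combination (√((k : ℝ) - 1) ^ j * (Real.sin (((j + 1 : ℕ) + 1 : ℝ) * φ) * Real.cos φ
      - Real.cos (((j + 1 : ℕ) + 1 : ℝ) * φ) * Real.sin φ)) * hq

lemma one_le_sub_one {k : ℕ} (hk : 2 ≤ k) : (1 : ℝ) ≤ (k : ℝ) - 1 := by
  have : (2 : ℝ) ≤ k := by exact_mod_cast hk
  linarith

lemma sqrt_pos_of_two_le {k : ℕ} (hk : 2 ≤ k) : 0 < √((k : ℝ) - 1) :=
  Real.sqrt_pos.mpr (by linarith [one_le_sub_one hk])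

/-- Covers the range that the substitution x = 2√(k-1) cos φ misses. The growth by a factor √(k-1)
is what lets the induction close. -/
lemma G_eval_pos_of_two_sqrt_le {k : ℕ} (hk : 2 ≤ k) {x : ℝ} (hx : 2 * √((k : ℝ) - 1) ≤ x)
    (j : ℕ) : 0 < (G k j).eval x ∧ √((k : ℝ) - 1) * (G k j).eval x ≤ (G k (j + 1)).eval x := by
  have hq : √((k : ℝ) - 1) ^ 2 = (k : ℝ) - 1 := Real.sq_sqrt (by linarith [one_le_sub_one hk])
  have hs := sqrt_pos_of_two_le hk
  induction j with
  | zero => simp [G_zero, G_one]; linarith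
  | succ j ih =>
    obtain ⟨h1, h2⟩ := ih
    have h3 : 0 < (G k (j + 1)).eval x := lt_of_lt_of_le (by positivity) h2
    refine ⟨h3, ?_⟩
    rw [G_eval_rec]
    nlinarith [mul_le_mul_of_nonneg_right hx h3.le, mul_le_mul_of_nonneg_left h2 hs.le]

/-- Points of `[0, 2√(k-1))` are of the form `2√(k-1) cos φ` with `0 < φ ≤ π`. -/
lemma exists_angle {k : ℕ} (hk : 2 ≤ k) {x : ℝ} (h1 : 0 ≤ x) (h2 : x < 2 * √((k : ℝ) - 1)) :
    ∃ φ, 0 < φ ∧ φ ≤ Real.pi ∧ x = 2 * √((k : ℝ) - 1) * Real.cos φ := by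
  have hs := sqrt_pos_of_two_le hk
  refine ⟨Real.arccos (x / (2 * √((k : ℝ) - 1))), ?_, Real.arccos_le_pi _, ?_⟩
  · rw [Real.arccos_pos, div_lt_one (by positivity)]
    exact h2
  · rw [Real.cos_arccos]
    · field_simp
    · have : 0 ≤ x / (2 * √((k : ℝ) - 1)) := by positivity
      linarith
    · rw [div_le_one (by positivity)]; exact h2.le

lemma pi_div_mem {j : ℕ} (hj : 1 ≤ j) :
    0 < Real.pi / (j + 1) ∧ Real.pi / (j + 1) ≤ Real.pi / 2 := by
  have : (1 : ℝ) ≤ j := by exact_mod_cast hj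
  refine ⟨by positivity, ?_⟩
  gcongr
  linarith

lemma two_sqrt_mul_cos_lt_iff {k : ℕ} (hk : 2 ≤ k) {φ ψ : ℝ} (hφ : φ ∈ Set.Icc 0 Real.pi)
    (hψ : ψ ∈ Set.Icc 0 Real.pi) :
    2 * √((k : ℝ) - 1) * Real.cos φ < 2 * √((k : ℝ) - 1) * Real.cos ψ ↔ ψ < φ := by
  have hs := sqrt_pos_of_two_le hk
  rw [mul_lt_mul_iff_right₀ (by positivity)]
  exact Real.strictAntiOn_cos.lt_iff_gt hφ hψ

lemma G_eval_pos_of_gt {k : ℕ} (hk : 2 ≤ k) {j : ℕ} (hj : 1 ≤ j) {x : ℝ}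
    (hx : 2 * √((k : ℝ) - 1) * Real.cos (Real.pi / (j + 1)) < x) : 0 < (G k j).eval x := by
  have hs := sqrt_pos_of_two_le hk
  obtain h | h := le_or_gt (2 * √((k : ℝ) - 1)) x
  · exact (G_eval_pos_of_two_sqrt_le hk h j).1
  · obtain ⟨p1, p2⟩ := pi_div_mem hj
    have hpi := Real.pi_pos
    have h0 : 0 ≤ x := by
      have : 0 ≤ Real.cos (Real.pi / (j + 1)) :=
        Real.cos_nonneg_of_mem_Icc ⟨by linarith, by linarith⟩
      have : 0 ≤ 2 * √((k : ℝ) - 1) * Real.cos (Real.pi / (j + 1)) := by positivity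
      linarith
    obtain ⟨φ, f1, f2, rfl⟩ := exists_angle hk h0 h
    rw [two_sqrt_mul_cos_lt_iff hk ⟨p1.le, by linarith⟩ ⟨f1.le, f2⟩, lt_div_iff₀ (by positivity)]
      at hx
    have hsin : 0 < Real.sin φ := Real.sin_pos_of_pos_of_lt_pi f1 (by nlinarith)
    have := G_eval_cos hk φ j
    have h3 : 0 < Real.sin ((j + 1) * φ) :=
      Real.sin_pos_of_pos_of_lt_pi (by positivity) (by linarith)
    have h4 : 0 < √((k : ℝ) - 1) ^ j * Real.sin ((j + 1) * φ) := by positivity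
    rw [← this] at h4
    exact pos_of_mul_pos_left h4 hsin.le

lemma isGreatest_zeros {k : ℕ} (hk : 2 ≤ k) {j : ℕ} (hj : 1 ≤ j) :
    IsGreatest {x : ℝ | (G k j).eval x = 0}
      (2 * √((k : ℝ) - 1) * Real.cos (Real.pi / (j + 1))) := by
  obtain ⟨p1, p2⟩ := pi_div_mem hj
  have hpi := Real.pi_pos
  constructor
  · have h := G_eval_cos hk (Real.pi / (j + 1)) j
    rw [mul_div_cancel₀ _ (by positivity : (j + 1 : ℝ) ≠ 0), Real.sin_pi, mul_zero] at h
    have hsin : 0 < Real.sin (Real.pi / (j + 1)) :=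
      Real.sin_pos_of_pos_of_lt_pi p1 (by linarith)
    exact (mul_eq_zero.mp h).resolve_right hsin.ne'
  · intro x hx
    by_contra! h
    exact (G_eval_pos_of_gt hk hj h).ne' hx

lemma lam_eq {k : ℕ} (hk : 2 ≤ k) {j : ℕ} (hj : 1 ≤ j) :
    lam k j = 2 * √((k : ℝ) - 1) * Real.cos (Real.pi / (j + 1)) :=
  (isGreatest_zeros hk hj).csSup_eq

lemma lam_one {k : ℕ} (hk : 2 ≤ k) : lam k 1 = 0 := by
  rw [lam_eq hk le_rfl]; norm_num

lemma lam_lt {k : ℕ} (hk : 2 ≤ k) {j : ℕ} (hj : 1 ≤ j) : lam k j < 2 * √((k : ℝ) - 1) := by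
  obtain ⟨p1, p2⟩ := pi_div_mem hj
  have hpi := Real.pi_pos
  have := (two_sqrt_mul_cos_lt_iff hk (φ := Real.pi / (j + 1)) (ψ := 0)
    ⟨p1.le, by linarith⟩ ⟨le_rfl, hpi.le⟩).mpr p1
  rw [lam_eq hk hj]
  simpa using this

lemma lam_mono {k : ℕ} (hk : 2 ≤ k) {i j : ℕ} (hi : 1 ≤ i) (hij : i ≤ j) :
    lam k i ≤ lam k j := by
  have hj := hi.trans hij
  obtain ⟨p1, p2⟩ := pi_div_mem hi
  obtain ⟨p3, p4⟩ := pi_div_mem hj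
  have hpi := Real.pi_pos
  rw [lam_eq hk hi, lam_eq hk hj, ← not_lt,
    two_sqrt_mul_cos_lt_iff hk ⟨p3.le, by linarith⟩ ⟨p1.le, by linarith⟩, not_lt]
  have : (i : ℝ) ≤ j := by exact_mod_cast hij
  gcongr

lemma lam_nonneg {k : ℕ} (hk : 2 ≤ k) {j : ℕ} (hj : 1 ≤ j) : 0 ≤ lam k j :=
  (lam_one hk).symm.trans_le (lam_mono hk le_rfl hj)

lemma lam_tendsto {k : ℕ} (hk : 2 ≤ k) :
    Filter.Tendsto (lam k) Filter.atTop (nhds (2 * √((k : ℝ) - 1))) := by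
  have h1 : Filter.Tendsto (fun j : ℕ => Real.pi / ((j : ℝ) + 1)) Filter.atTop (nhds 0) := by
    have := (tendsto_one_div_add_atTop_nhds_zero_nat (𝕜 := ℝ)).const_mul Real.pi
    simpa [mul_one_div, div_eq_mul_inv] using this
  have h2 := ((Real.continuous_cos.tendsto 0).comp h1).const_mul (2 * √((k : ℝ) - 1))
  rw [Real.cos_zero, mul_one] at h2
  refine h2.congr' ?_
  filter_upwards [Filter.eventually_ge_atTop 1] with j hj
  rw [lam_eq hk hj]; rfl

lemma iUnion_Ioc_lam {k : ℕ} (hk : 2 ≤ k) :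
    (⋃ j ∈ Set.Ici (1 : ℕ), Set.Ioc (lam k j) (lam k (j + 1))) =
      Set.Ioo (0 : ℝ) (2 * √((k : ℝ) - 1)) := by
  ext x
  simp only [Set.mem_iUnion, Set.mem_Ici, Set.mem_Ioc, Set.mem_Ioo, exists_prop]
  constructor
  · rintro ⟨j, hj, h1, h2⟩
    exact ⟨(lam_nonneg hk hj).trans_lt h1,
      h2.trans_lt (lam_lt hk (by omega))⟩
  · rintro ⟨h0, h1⟩
    have hex : ∃ j, 1 ≤ j ∧ x ≤ lam k j :=
      ((Filter.eventually_ge_atTop 1).and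
        (((lam_tendsto hk).eventually_const_lt h1).mono fun _ h => h.le)).exists
    classical
    obtain ⟨hj, hx⟩ := Nat.find_spec hex
    -- The least index with x ≤ λ^(j) is not 1, since λ^(1) = 0 < x; so its predecessor is a legal
    -- index.
    have hne : Nat.find hex ≠ 1 := by
      intro h
      rw [h, lam_one hk] at hx
      linarith
    refine ⟨Nat.find hex - 1, by omega, ?_, by rwa [Nat.sub_add_cancel hj]⟩
    have := Nat.find_min hex (m := Nat.find hex - 1) (by omega)
    by_contra! h
    exact this ⟨by omega, h⟩

/-! ### Signs at θ and the Christoffel–Darboux kernel -/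

lemma G_eval_pos_of_lam_lt {k : ℕ} (hk : 2 ≤ k) {n m : ℕ} (hm : m ≤ n) {θ : ℝ}
    (h : lam k n < θ) : 0 < (G k m).eval θ := by
  rcases Nat.eq_zero_or_pos m with rfl | hm0
  · simp [G_zero]
  · refine G_eval_pos_of_gt hk hm0 ?_
    rw [← lam_eq hk hm0]
    exact (lam_mono hk hm0 hm).trans_lt h

lemma G_eval_nonpos {k : ℕ} (hk : 2 ≤ k) {n : ℕ} (hn : 1 ≤ n) {θ : ℝ}
    (h1 : lam k n < θ) (h2 : θ ≤ lam k (n + 1)) : (G k (n + 1)).eval θ ≤ 0 := by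
  have hs := sqrt_pos_of_two_le hk
  have hpi := Real.pi_pos
  have h0 : 0 ≤ θ := ((lam_nonneg hk hn).trans_lt h1).le
  obtain ⟨φ, f1, f2, rfl⟩ := exists_angle hk h0 (h2.trans_lt (lam_lt hk (by omega)))
  obtain ⟨p1, p2⟩ := pi_div_mem hn
  obtain ⟨p3, p4⟩ := pi_div_mem (Nat.le_add_left 1 n)
  rw [lam_eq hk hn, two_sqrt_mul_cos_lt_iff hk ⟨p1.le, by linarith⟩ ⟨f1.le, f2⟩,
    lt_div_iff₀ (by positivity)] at h1
  rw [lam_eq hk (by omega), ← not_lt,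
    two_sqrt_mul_cos_lt_iff hk ⟨p3.le, by linarith⟩ ⟨f1.le, f2⟩, not_lt,
    div_le_iff₀ (by positivity)] at h2
  have hn' : (1 : ℝ) ≤ n := by exact_mod_cast hn
  push_cast at h2
  have hsin : 0 < Real.sin φ := Real.sin_pos_of_pos_of_lt_pi f1 (by nlinarith)
  -- The angle (n+2)φ lies in [π, 2π]: at least π by `h2`, at most 2π because (n+1)φ < π.
  have hneg : Real.sin (((n + 1 : ℕ) + 1 : ℝ) * φ) ≤ 0 := by
    have : 0 ≤ Real.sin (((n + 1 : ℕ) + 1 : ℝ) * φ - Real.pi) := by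
      push_cast
      exact Real.sin_nonneg_of_nonneg_of_le_pi (by linarith) (by nlinarith)
    rw [Real.sin_sub_pi] at this
    linarith
  have h3 : √((k : ℝ) - 1) ^ (n + 1) * Real.sin (((n + 1 : ℕ) + 1 : ℝ) * φ) ≤ 0 :=
    mul_nonpos_of_nonneg_of_nonpos (by positivity) hneg
  rw [← G_eval_cos hk] at h3
  exact nonpos_of_mul_nonpos_left h3 hsin

/-- The Christoffel–Darboux kernel `∑_j (k-1)^{2j} G_{i-2j}(θ) G_{i-2j}(x)` as a polynomial
in `x`. -/
noncomputable def kernel (k : ℕ) (θ : ℝ) : ℕ → ℝ[X]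
  | 0 => 1
  | 1 => C θ * X
  | (i + 2) => C ((G k (i + 2)).eval θ) * G k (i + 2) + C (((k : ℝ) - 1) ^ 2) * kernel k θ i

lemma kernel_eval_neg (k : ℕ) (θ x : ℝ) :
    ∀ i, (kernel k θ i).eval (-x) = (-1) ^ i * (kernel k θ i).eval x
  | 0 => by simp [kernel]
  | 1 => by simp [kernel]
  | i + 2 => by
    simp only [kernel, eval_add, eval_mul, eval_C, G_eval_neg, kernel_eval_neg k θ x i]
    ring

/-- Christoffel–Darboux in steps of two: G_{i+4} = (x² - 2(k-1)) G_{i+2} - (k-1)² G_i, so the cross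
difference at i+2 equals (x² - θ²) G_{i+2}(θ) G_{i+2}(x) plus (k-1)² times the one at i. -/
lemma sq_sub_sq_mul_kernel_eval (k : ℕ) (θ x : ℝ) : ∀ i,
    (x ^ 2 - θ ^ 2) * (kernel k θ i).eval x =
      (G k i).eval θ * (G k (i + 2)).eval x - (G k (i + 2)).eval θ * (G k i).eval x
  | 0 => by
    simp only [kernel, zero_add, G_eval_rec, G_zero, G_one, eval_one, eval_X]; ring
  | 1 => by
    simp only [kernel, G_eval_rec, G_zero, G_one, eval_one, eval_X, eval_mul, eval_C, zero_add]
    ring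
  | i + 2 => by
    have ih := sq_sub_sq_mul_kernel_eval k θ x i
    simp only [kernel, eval_add, eval_mul, eval_C]
    have a1 := G_eval_rec k (i + 2) x
    have a2 := G_eval_rec k (i + 1) x
    have a3 := G_eval_rec k i x
    have b1 := G_eval_rec k (i + 2) θ
    have b2 := G_eval_rec k (i + 1) θ
    have b3 := G_eval_rec k i θ
    have a4 : (G k (i + 2 + 2)).eval x = (x ^ 2 - 2 * ((k : ℝ) - 1)) * (G k (i + 2)).eval x
        - ((k : ℝ) - 1) ^ 2 * (G k i).eval x := by
      linear_combination a1 + x * a2 + ((k : ℝ) - 1) * a3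
    have b4 : (G k (i + 2 + 2)).eval θ = (θ ^ 2 - 2 * ((k : ℝ) - 1)) * (G k (i + 2)).eval θ
        - ((k : ℝ) - 1) ^ 2 * (G k i).eval θ := by
      linear_combination b1 + θ * b2 + ((k : ℝ) - 1) * b3
    rw [a4, b4]
    linear_combination ((k : ℝ) - 1) ^ 2 * ih

lemma kernel_eval_degree_pos {k : ℕ} (hk : 2 ≤ k) {θ : ℝ} (h0 : 0 < θ) :
    ∀ i, (∀ m ≤ i, 0 < (G k m).eval θ) → 0 < (kernel k θ i).eval (k : ℝ)
  | 0, _ => by simp [kernel]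
  | 1, _ => by simp [kernel]; positivity
  | i + 2, h => by
    have := one_le_sub_one hk
    have h1 := kernel_eval_degree_pos hk h0 i fun m hm => h m (by omega)
    have h2 : 0 < (G k (i + 2)).eval (k : ℝ) := by
      rw [G_eval_degree]
      exact Finset.sum_pos (fun _ _ => by positivity) (by simp)
    have h3 := h (i + 2) le_rfl
    simp only [kernel, eval_add, eval_mul, eval_C]
    positivity

/-! ### Spectra of polynomials in a symmetric matrix -/

section Matrices

variable {V : Type*} [Fintype V] [DecidableEq V]

open Unitary in
lemma roots_charpoly_aeval {A : Matrix V V ℝ} (hA : A.IsHermitian) (p : ℝ[X]) :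
    (aeval A p).charpoly.roots = A.charpoly.roots.map fun x => p.eval x := by
  have hdiag : aeval A p = conjStarAlgAut ℝ _ hA.eigenvectorUnitary
      (Matrix.diagonal fun i => p.eval (hA.eigenvalues i)) := by
    conv_lhs => rw [hA.spectral_theorem]
    have h1 := Polynomial.aeval_algHom_apply
      ((conjStarAlgAut ℝ (Matrix V V ℝ) hA.eigenvectorUnitary : _ ≃⋆ₐ[ℝ] _) :
        Matrix V V ℝ →⋆ₐ[ℝ] Matrix V V ℝ).toAlgHom
      (Matrix.diagonal (RCLike.ofReal ∘ hA.eigenvalues)) p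
    have h2 := Polynomial.aeval_algHom_apply (Matrix.diagonalAlgHom ℝ (n := V) (α := ℝ))
      (RCLike.ofReal ∘ hA.eigenvalues) p
    refine h1.trans ?_
    have h3 : aeval (Matrix.diagonal (RCLike.ofReal ∘ hA.eigenvalues : V → ℝ)) p =
        Matrix.diagonal fun i => p.eval (hA.eigenvalues i) := by
      refine h2.trans ?_
      simp only [Matrix.diagonalAlgHom_apply]
      congr 1
      ext i
      have := Polynomial.aeval_algHom_apply (Pi.evalAlgHom ℝ (fun _ : V => ℝ) i)
        (RCLike.ofReal ∘ hA.eigenvalues) p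
      refine this.symm.trans ?_
      simp [Polynomial.aeval_def, Polynomial.eval₂_eq_eval_map]
    rw [h3]; rfl
  have hchar : (aeval A p).charpoly = ∏ i, (X - C (p.eval (hA.eigenvalues i))) := by
    rw [hdiag, conjStarAlgAut_apply, Matrix.charpoly_mul_comm, ← mul_assoc]
    simp [Matrix.charpoly_diagonal]
  rw [hchar, hA.roots_charpoly_eq_eigenvalues, Polynomial.roots_prod]
  · simp
  · simp [Finset.prod_ne_zero_iff, Polynomial.X_sub_C_ne_zero]

lemma isHermitian_aeval {A : Matrix V V ℝ} (hA : A.IsHermitian) (p : ℝ[X]) :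
    (aeval A p).IsHermitian := by
  induction p using Polynomial.induction_on' with
  | add p q hp hq => rw [map_add]; exact hp.add hq
  | monomial n a =>
    rw [aeval_monomial, ← Algebra.smul_def]
    exact (hA.pow n).smul (IsSelfAdjoint.all a)

lemma trace_aeval {A : Matrix V V ℝ} (hA : A.IsHermitian) (p : ℝ[X]) :
    (aeval A p).trace = (A.charpoly.roots.map fun x => p.eval x).sum := by
  rw [← roots_charpoly_aeval hA,
    Matrix.trace_eq_sum_roots_charpoly_of_splits (isHermitian_aeval hA p).splits_charpoly]

/-- The second largest eigenvalue is at most `θ` exactly if at most one eigenvalue exceeds `θ`. -/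
lemma eigenvalues₀_one_le_iff {A : Matrix V V ℝ} (hA : A.IsHermitian) (hV : 1 < Fintype.card V)
    (θ : ℝ) : hA.eigenvalues₀ ⟨1, hV⟩ ≤ θ ↔
      (A.charpoly.roots.filter fun x => θ < x).card ≤ 1 := by
  have hcard : (A.charpoly.roots.filter fun x => θ < x).card =
      (Finset.univ.filter fun i => θ < hA.eigenvalues₀ i).card := by
    rw [hA.roots_charpoly_eq_eigenvalues₀, Multiset.filter_map, Multiset.card_map]
    rfl
  rw [hcard]
  constructor
  · intro h
    refine Finset.card_le_one.mpr fun i hi j hj => ?_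
    have key : ∀ i : Fin (Fintype.card V), θ < hA.eigenvalues₀ i → i.val = 0 := by
      intro i hi
      by_contra h0
      have : (⟨1, hV⟩ : Fin (Fintype.card V)) ≤ i := by
        rw [Fin.le_def]; exact Nat.one_le_iff_ne_zero.mpr h0
      linarith [hA.eigenvalues₀_antitone this]
    simp only [Finset.mem_filter, Finset.mem_univ, true_and] at hi hj
    exact Fin.ext ((key i hi).trans (key j hj).symm)
  · intro h
    by_contra! hlt
    have h01 : (⟨0, by omega⟩ : Fin (Fintype.card V)) ≤ ⟨1, hV⟩ := by simp [Fin.le_def]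
    have := Finset.card_le_one.mp h ⟨0, by omega⟩
      (by simpa using hlt.trans_le (hA.eigenvalues₀_antitone h01)) ⟨1, hV⟩ (by simpa using hlt)
    simp at this

/-- Symmetry makes -d the only element below -θ. The pair ±d contributes 2 f(d), and everything else
lies in [-θ, θ], where f is nonpositive. -/
lemma sum_map_le_of_even {E : Multiset ℝ} {θ d : ℝ} (hneg : E.map (fun x => -x) = E)
    (hd : E.filter (fun x => θ < x) = {d}) {f : ℝ → ℝ} (hf : ∀ x, f (-x) = f x)
    (hθ : 0 ≤ θ) (hle : ∀ x, |x| ≤ θ → f x ≤ 0) : (E.map f).sum ≤ 2 * f d := by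
  have hd' : E.filter (fun x => θ < -x) = {-d} := by
    rw [← Multiset.map_singleton, ← hd]
    conv_lhs => rw [← hneg]
    rw [Multiset.filter_map]
    congr 1
    exact Multiset.filter_congr fun x _ => by simp
  have hsplit : E = E.filter (fun x => θ < x) + (E.filter (fun x => θ < -x) +
      E.filter (fun x => |x| ≤ θ)) := by
    conv_lhs => rw [← Multiset.filter_add_not (fun x => θ < x) E]
    congr 1
    conv_lhs => rw [← Multiset.filter_add_not (fun x => θ < -x) (E.filter fun x => ¬ θ < x)]
    rw [Multiset.filter_filter, Multiset.filter_filter]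
    congr 1
    · refine Multiset.filter_congr fun x _ => ⟨fun h => h.1, fun h => ⟨h, by linarith⟩⟩
    · refine Multiset.filter_congr fun x _ => ?_
      rw [abs_le]
      constructor
      · rintro ⟨h1, h2⟩; constructor <;> linarith
      · rintro ⟨h1, h2⟩; constructor <;> linarith
  rw [hsplit, hd, hd', Multiset.map_add, Multiset.map_add, Multiset.sum_add, Multiset.sum_add]
  have : ((E.filter fun x => |x| ≤ θ).map f).sum ≤ 0 := by
    have := Multiset.sum_map_le_sum_map f (fun _ => 0) (s := E.filter fun x => |x| ≤ θ)
      fun x hx =>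
      hle x (Multiset.mem_filter.mp hx).2
    simpa using this
  simp only [Multiset.map_singleton, Multiset.sum_singleton, hf]
  linarith

end Matrices

/-! ### Non-backtracking walks, trace estimates and the spectral bound -/

section Graphs

variable {V : Type*} [Fintype V] [DecidableEq V] (Γ : SimpleGraph V) [DecidableRel Γ.Adj]

/-- The number of non-backtracking walks with `i + 1` edges from `u` whose last edge goes from
`x` to `y`. -/
def nbWalks (u : V) : ℕ → V → V → ℕ
  | 0, x, y => if x = u ∧ Γ.Adj x y then 1 else 0
  | i + 1, x, y => if Γ.Adj x y then ∑ w ∈ Finset.univ.erase y, nbWalks u i w x else 0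

lemma nbWalks_eq_zero (u : V) (i : ℕ) {x y : V} (h : ¬ Γ.Adj x y) : nbWalks Γ u i x y = 0 := by
  cases i <;> simp [nbWalks, h]

lemma adjMatrix_mul_nbWalks (u : V) (i : ℕ) (x y : V) :
    Γ.adjMatrix ℝ y x * nbWalks Γ u i x y = nbWalks Γ u i x y := by
  by_cases h : Γ.Adj x y
  · rw [SimpleGraph.adjMatrix_apply, if_pos h.symm, one_mul]
  · simp [nbWalks_eq_zero Γ u i h]

/-- Inclusion–exclusion form of the recursion: all continuations minus the one that turns back. It
makes the counts accessible to matrix algebra. -/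
lemma nbWalks_succ (u : V) (i : ℕ) (x y : V) :
    (nbWalks Γ u (i + 1) x y : ℝ) =
      Γ.adjMatrix ℝ x y * (∑ w, (nbWalks Γ u i w x : ℝ) - nbWalks Γ u i y x) := by
  have h := Finset.add_sum_erase Finset.univ (fun w => (nbWalks Γ u i w x : ℝ)) (Finset.mem_univ y)
  by_cases hxy : Γ.Adj x y
  · rw [← h]
    simp [nbWalks, hxy]
  · simp [nbWalks, hxy]

variable {Γ} {k : ℕ}

lemma adjMatrix_mulVec_const {V : Type*} [Fintype V] {Γ : SimpleGraph V} [DecidableRel Γ.Adj]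
    (hΓ : Γ.IsRegularOfDegree k) (a : ℝ) :
    (Γ.adjMatrix ℝ).mulVec (fun _ => a) = fun _ => k * a :=
  funext fun _ => SimpleGraph.adjMatrix_mulVec_const_apply_of_regular hΓ

lemma sum_adjMatrix_row {V : Type*} [Fintype V] {Γ : SimpleGraph V} [DecidableRel Γ.Adj]
    (hΓ : Γ.IsRegularOfDegree k) (y : V) :
    ∑ x, Γ.adjMatrix ℝ y x = k := by
  have := congrFun (adjMatrix_mulVec_const hΓ 1) y
  simpa [Matrix.mulVec, dotProduct] using this

lemma sum_nbWalks_succ (u : V) (i : ℕ) (y : V) :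
    ∑ x, (nbWalks Γ u (i + 1) x y : ℝ) =
      ∑ x, (∑ w, (nbWalks Γ u i w x : ℝ)) * Γ.adjMatrix ℝ x y - ∑ x, (nbWalks Γ u i y x : ℝ) := by
  rw [← Finset.sum_sub_distrib]
  refine Finset.sum_congr rfl fun x _ => ?_
  rw [nbWalks_succ, mul_sub, adjMatrix_mul_nbWalks, mul_comm]

lemma sum_nbWalks_snd_succ (hΓ : Γ.IsRegularOfDegree k) (u : V) (i : ℕ) (y : V) :
    ∑ x, (nbWalks Γ u (i + 1) y x : ℝ) = ((k : ℝ) - 1) * ∑ x, (nbWalks Γ u i x y : ℝ) := by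
  simp only [nbWalks_succ, mul_sub, adjMatrix_mul_nbWalks, Finset.sum_sub_distrib]
  rw [← Finset.sum_mul, sum_adjMatrix_row hΓ]
  ring

/-- The counts obey the recurrence of the `F i`. A walk of at least one edge has k - 1
non-backtracking continuations, but at the second step all k first edges can be retraced, whence the
exceptional F_2 = x² - k. -/
lemma aeval_F_succ_apply (hΓ : Γ.IsRegularOfDegree k) (i : ℕ) (u y : V) :
    aeval (Γ.adjMatrix ℝ) (F k (i + 1)) u y = ∑ x, (nbWalks Γ u i x y : ℝ) := by
  have h0 : ∀ u y, (∑ x, (nbWalks Γ u 0 x y : ℝ)) = Γ.adjMatrix ℝ u y := by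
    intro u y
    simp only [nbWalks, SimpleGraph.adjMatrix_apply]
    rw [Finset.sum_eq_single u]
    · simp
    · intro b _ hb; simp [hb]
    · simp
  induction i using Nat.twoStepInduction generalizing y with
  | zero => rw [h0]; simp [F]
  | one =>
    rw [sum_nbWalks_succ]
    simp only [h0]
    have : ∑ x, (nbWalks Γ u 0 y x : ℝ) = (k : ℝ) * (1 : Matrix V V ℝ) u y := by
      by_cases huy : y = u
      · subst huy
        rw [Matrix.one_apply_eq, mul_one, ← sum_adjMatrix_row hΓ y]
        simp [nbWalks, SimpleGraph.adjMatrix_apply]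
      · rw [Matrix.one_apply_ne (Ne.symm huy)]
        simp [nbWalks, huy]
    rw [this]
    rw [show F k (1 + 1) = X * X - C (k : ℝ) by rw [← sq]; rfl, map_sub, map_mul, aeval_X, aeval_C,
      Matrix.sub_apply, Matrix.mul_apply, Algebra.algebraMap_eq_smul_one, Matrix.smul_apply,
      smul_eq_mul]
  | more i h1 h2 =>
    rw [show F k (i + 2 + 1) = F k (i + 1 + 1) * X - C ((k : ℝ) - 1) * F k (i + 1) by
      rw [mul_comm _ X]; rfl]
    rw [sum_nbWalks_succ, sum_nbWalks_snd_succ hΓ]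
    simp only [map_sub (aeval _), map_mul, aeval_X, aeval_C, Matrix.sub_apply, Matrix.mul_apply, h2]
    rw [← h1, ← Matrix.mul_apply, ← Algebra.smul_def, Matrix.smul_apply, smul_eq_mul]

/-- A real matrix with entries in `ℕ`. -/
def IsNatValued {V : Type*} (B : Matrix V V ℝ) : Prop := ∀ u v, ∃ n : ℕ, B u v = n

lemma IsNatValued.nonneg {V : Type*} {B : Matrix V V ℝ} (h : IsNatValued B) (u v : V) : 0 ≤ B u v := by
  obtain ⟨n, hn⟩ := h u v
  rw [hn]; positivity

lemma isNatValued_aeval_F (hΓ : Γ.IsRegularOfDegree k) (i : ℕ) :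
    IsNatValued (aeval (Γ.adjMatrix ℝ) (F k i)) := by
  intro u v
  cases i with
  | zero =>
    by_cases h : u = v
    · exact ⟨1, by simp [F, h]⟩
    · exact ⟨0, by simp [F, h]⟩
  | succ i => exact ⟨∑ x, nbWalks Γ u i x v, by rw [aeval_F_succ_apply hΓ]; simp⟩

lemma isNatValued_aeval_G (hΓ : Γ.IsRegularOfDegree k) (i : ℕ) :
    IsNatValued (aeval (Γ.adjMatrix ℝ) (G k i)) := by
  intro u v
  choose n hn using fun j => isNatValued_aeval_F hΓ j u v
  refine ⟨∑ j ∈ Finset.range (i / 2 + 1), n (i - 2 * j), ?_⟩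
  rw [G, map_sum, Matrix.sum_apply]
  simp [hn]

lemma aeval_G_le (hΓ : Γ.IsRegularOfDegree k) (i m : ℕ) (u v : V) :
    aeval (Γ.adjMatrix ℝ) (G k i) u v ≤ aeval (Γ.adjMatrix ℝ) (G k (i + 2 * m)) u v := by
  induction m with
  | zero => simp
  | succ m ih =>
    rw [show i + 2 * (m + 1) = i + 2 * m + 2 by ring, G_add_two, map_add, Matrix.add_apply]
    linarith [(isNatValued_aeval_F hΓ (i + 2 * m + 2)).nonneg u v]

lemma aeval_mulVec_one (hΓ : Γ.IsRegularOfDegree k) (p : ℝ[X]) (v : V) :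
    ∑ w, aeval (Γ.adjMatrix ℝ) p v w = p.eval (k : ℝ) := by
  have h : (aeval (Γ.adjMatrix ℝ) p).mulVec (fun _ => 1) = fun _ => p.eval (k : ℝ) := by
    induction p using Polynomial.induction_on' with
    | add p q hp hq => ext; simp [Matrix.add_mulVec, hp, hq]
    | monomial n a =>
      have hpow : (Γ.adjMatrix ℝ ^ n).mulVec (fun _ => 1) = fun _ => (k : ℝ) ^ n := by
        induction n with
        | zero => simp
        | succ n ih =>
          rw [pow_succ', ← Matrix.mulVec_mulVec, ih, adjMatrix_mulVec_const hΓ]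
          ext v
          ring
      rw [aeval_monomial, ← Algebra.smul_def, Matrix.smul_mulVec, hpow]
      ext; simp
  have := congrFun h v
  simpa [Matrix.mulVec, dotProduct] using this

lemma trace_aeval_mul (p r : ℝ[X]) :
    (aeval (Γ.adjMatrix ℝ) (p * r)).trace =
      ∑ u, ∑ v, aeval (Γ.adjMatrix ℝ) p u v * aeval (Γ.adjMatrix ℝ) r u v := by
  rw [map_mul, Matrix.trace]
  simp only [Matrix.diag_apply, Matrix.mul_apply]
  refine Finset.sum_congr rfl fun u _ => Finset.sum_congr rfl fun v _ => ?_
  have := (isHermitian_aeval (Γ.isHermitian_adjMatrix ℝ) r).apply u v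
  rw [← this]; simp

lemma trace_aeval_F_mul_G_nonneg (hΓ : Γ.IsRegularOfDegree k) (i j : ℕ) :
    0 ≤ (aeval (Γ.adjMatrix ℝ) (F k i * G k j)).trace := by
  rw [trace_aeval_mul]
  exact Finset.sum_nonneg fun u _ => Finset.sum_nonneg fun v _ =>
    mul_nonneg ((isNatValued_aeval_F hΓ i).nonneg u v) ((isNatValued_aeval_G hΓ j).nonneg u v)

/-- The trace is the sum of products of corresponding entries. For natural entries a ≤ b one has ba
≥ a² ≥ a, and the entries of G_i(A) in each row sum to G_i(k). -/
lemma le_trace_aeval_G_mul_G (hΓ : Γ.IsRegularOfDegree k) (i m : ℕ) :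
    Fintype.card V * (G k i).eval (k : ℝ) ≤
      (aeval (Γ.adjMatrix ℝ) (G k (i + 2 * m) * G k i)).trace := by
  have h : (Fintype.card V : ℝ) * (G k i).eval (k : ℝ) =
      ∑ _u : V, (G k i).eval (k : ℝ) := by simp
  rw [trace_aeval_mul, h]
  refine Finset.sum_le_sum fun u _ => ?_
  rw [← aeval_mulVec_one hΓ _ u]
  refine Finset.sum_le_sum fun v _ => ?_
  have h1 := aeval_G_le hΓ i m u v
  obtain ⟨n, hn⟩ := isNatValued_aeval_G hΓ i u v
  rw [hn] at h1 ⊢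
  have h2 : (n : ℝ) ≤ n * n := by exact_mod_cast Nat.le_mul_self n
  exact h2.trans (by gcongr)

lemma trace_aeval_F_mul_kernel_nonneg (hΓ : Γ.IsRegularOfDegree k) {θ : ℝ} (j : ℕ) :
    ∀ i, (∀ m ≤ i, 0 < (G k m).eval θ) →
      0 ≤ (aeval (Γ.adjMatrix ℝ) (F k j * kernel k θ i)).trace
  | 0, _ => by
    simpa [kernel, G_zero] using trace_aeval_F_mul_G_nonneg hΓ j 0
  | 1, h => by
    rw [show F k j * kernel k θ 1 = C ((G k 1).eval θ) * (F k j * G k 1) by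
      rw [kernel, G_one, eval_X]; ring, map_mul, aeval_C, ← Algebra.smul_def, Matrix.trace_smul]
    exact mul_nonneg (h 1 le_rfl).le (trace_aeval_F_mul_G_nonneg hΓ j 1)
  | i + 2, h => by
    rw [show F k j * kernel k θ (i + 2) = C ((G k (i + 2)).eval θ) * (F k j * G k (i + 2)) +
      C (((k : ℝ) - 1) ^ 2) * (F k j * kernel k θ i) by rw [kernel]; ring, map_add, map_mul,
      map_mul (aeval _) (C (((k : ℝ) - 1) ^ 2)), aeval_C, aeval_C, ← Algebra.smul_def,
      ← Algebra.smul_def, Matrix.trace_add, Matrix.trace_smul, Matrix.trace_smul]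
    exact add_nonneg (mul_nonneg (h _ le_rfl).le (trace_aeval_F_mul_G_nonneg hΓ j _))
      (mul_nonneg (sq_nonneg _)
        (trace_aeval_F_mul_kernel_nonneg hΓ j i fun m hm => h m (by omega)))

/-- The shift m keeps the left factor fixed while the induction lowers the kernel index by two. -/
lemma le_trace_aeval_G_mul_kernel (hΓ : Γ.IsRegularOfDegree k) {θ : ℝ} :
    ∀ i m, (∀ m ≤ i, 0 < (G k m).eval θ) → Fintype.card V * (kernel k θ i).eval (k : ℝ) ≤
      (aeval (Γ.adjMatrix ℝ) (G k (i + 2 * m) * kernel k θ i)).trace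
  | 0, m, _ => by
    simpa [kernel, G_zero] using le_trace_aeval_G_mul_G hΓ 0 m
  | 1, m, h => by
    rw [show G k (1 + 2 * m) * kernel k θ 1 = C ((G k 1).eval θ) * (G k (1 + 2 * m) * G k 1) by
      rw [kernel, G_one, eval_X]; ring, map_mul, aeval_C, ← Algebra.smul_def, Matrix.trace_smul,
      show kernel k θ 1 = C ((G k 1).eval θ) * G k 1 by rw [kernel, G_one, eval_X],
      eval_mul, eval_C, mul_left_comm, smul_eq_mul]
    exact mul_le_mul_of_nonneg_left (le_trace_aeval_G_mul_G hΓ 1 m) (h 1 le_rfl).le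
  | i + 2, m, h => by
    rw [show G k (i + 2 + 2 * m) * kernel k θ (i + 2) =
      C ((G k (i + 2)).eval θ) * (G k (i + 2 + 2 * m) * G k (i + 2)) +
      C (((k : ℝ) - 1) ^ 2) * (G k (i + 2 * (m + 1)) * kernel k θ i) by
        rw [kernel, show i + 2 + 2 * m = i + 2 * (m + 1) by ring]; ring, map_add, map_mul,
      map_mul (aeval _) (C (((k : ℝ) - 1) ^ 2)), aeval_C, aeval_C, ← Algebra.smul_def,
      ← Algebra.smul_def, Matrix.trace_add, Matrix.trace_smul, Matrix.trace_smul, kernel,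
      eval_add, eval_mul, eval_mul, eval_C, eval_C, mul_add, mul_left_comm,
      mul_left_comm _ (((k : ℝ) - 1) ^ 2)]
    exact add_le_add
      (mul_le_mul_of_nonneg_left (le_trace_aeval_G_mul_G hΓ (i + 2) m) (h _ le_rfl).le)
      (mul_le_mul_of_nonneg_left (le_trace_aeval_G_mul_kernel hΓ i (m + 1) fun m hm =>
        h m (by omega)) (sq_nonneg _))

lemma degree_mem_roots_charpoly [Nonempty V] (hΓ : Γ.IsRegularOfDegree k) :
    (k : ℝ) ∈ (Γ.adjMatrix ℝ).charpoly.roots := by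
  rw [mem_roots (Matrix.charpoly_monic _).ne_zero, IsRoot, Matrix.eval_charpoly,
    ← Matrix.exists_mulVec_eq_zero_iff]
  refine ⟨fun _ => 1, fun h => one_ne_zero (congrFun h (Classical.arbitrary V)), ?_⟩
  ext v
  rw [Matrix.sub_mulVec, Pi.sub_apply, adjMatrix_mulVec_const hΓ]
  simp

/-- The spectrum of a bipartite graph is symmetric about `0`. -/
lemma map_neg_roots_charpoly (hb : Γ.IsBipartite) :
    (Γ.adjMatrix ℝ).charpoly.roots.map (fun x => -x) = (Γ.adjMatrix ℝ).charpoly.roots := by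
  obtain ⟨c⟩ := hb
  set A := Γ.adjMatrix ℝ
  -- Signing the two colour classes oppositely conjugates A into -A.
  set S : Matrix V V ℝ := Matrix.diagonal fun v => if c v = 0 then 1 else -1
  have hS : S * S = 1 := by
    rw [Matrix.diagonal_mul_diagonal, ← Matrix.diagonal_one]
    congr 1; ext v; split_ifs <;> simp
  have hSA : S * (A * S) = -A := by
    ext u v
    rw [Matrix.diagonal_mul, Matrix.mul_diagonal, Matrix.neg_apply]
    by_cases h : Γ.Adj u v
    · have hc := c.valid h
      have : ∀ a b : Fin 2, a ≠ b →
          (if a = 0 then (1 : ℝ) else -1) * (if b = 0 then (1 : ℝ) else -1) = -1 := by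
        intro a b hab
        fin_cases a <;> fin_cases b <;> simp_all
      linear_combination A u v * this _ _ hc
    · simp [A, h]
  have h1 := roots_charpoly_aeval (Γ.isHermitian_adjMatrix ℝ) (-X : ℝ[X])
  have h2 : (aeval A (-X : ℝ[X])).charpoly = A.charpoly := by
    rw [map_neg, aeval_X, ← hSA, Matrix.charpoly_mul_comm, mul_assoc, hS, mul_one]
  rw [h2] at h1
  simpa using h1.symm

/-- The linear programming bound, with test function P K = (x² - θ²) K². -/
lemma card_mul_sub_le [Nonempty V] (hb : Γ.IsBipartite) (hΓ : Γ.IsRegularOfDegree k) (hk : 2 ≤ k)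
    {θ : ℝ} (hθ0 : 0 < θ) (hθk : θ < k)
    (hle : ((Γ.adjMatrix ℝ).charpoly.roots.filter fun x => θ < x).card ≤ 1) {s : ℕ}
    (hpos : ∀ m ≤ s, 0 < (G k m).eval θ) (hneg : (G k (s + 2)).eval θ ≤ 0) :
    Fintype.card V * ((G k s).eval θ - (G k (s + 2)).eval θ) ≤
      2 * ((G k s).eval θ * (F k (s + 2)).eval (k : ℝ) +
        ((G k s).eval θ - (G k (s + 2)).eval θ) * (G k s).eval (k : ℝ)) := by
  set g := (G k s).eval θ
  set d := g - (G k (s + 2)).eval θ with hd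
  have hg : 0 < g := hpos s le_rfl
  have hd0 : 0 ≤ d := by linarith
  set P : ℝ[X] := C g * F k (s + 2) + C d * G k s
  set K := kernel k θ s
  have hP : ∀ x, P.eval x = (x ^ 2 - θ ^ 2) * K.eval x := by
    intro x
    rw [sq_sub_sq_mul_kernel_eval, G_add_two k s]
    simp only [P, hd, G_add_two k s, eval_add, eval_mul, eval_C]
    ring
  -- The degree k is an eigenvalue above θ, and at most one is allowed, counted with multiplicity.
  have hfilter : (Γ.adjMatrix ℝ).charpoly.roots.filter (fun x => θ < x) = {(k : ℝ)} := by
    have hmem : (k : ℝ) ∈ (Γ.adjMatrix ℝ).charpoly.roots.filter (fun x => θ < x) :=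
      Multiset.mem_filter.mpr ⟨degree_mem_roots_charpoly hΓ, hθk⟩
    have h1 : ((Γ.adjMatrix ℝ).charpoly.roots.filter fun x => θ < x).card = 1 :=
      le_antisymm hle (Multiset.card_pos_iff_exists_mem.mpr ⟨_, hmem⟩)
    obtain ⟨a, ha⟩ := Multiset.card_eq_one.mp h1
    rw [ha] at hmem ⊢
    rw [Multiset.mem_singleton.mp hmem]
  have hupper : (aeval (Γ.adjMatrix ℝ) (P * K)).trace ≤ 2 * (P * K).eval (k : ℝ) := by
    rw [trace_aeval (Γ.isHermitian_adjMatrix ℝ)]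
    refine sum_map_le_of_even (f := fun x => (P * K).eval x) (map_neg_roots_charpoly hb) hfilter
      ?_ hθ0.le ?_
    · intro x
      have : ((-1 : ℝ) ^ s) ^ 2 = 1 := by rw [← pow_mul, mul_comm, pow_mul]; simp
      simp only [eval_mul, hP, K, kernel_eval_neg]
      linear_combination (x ^ 2 - θ ^ 2) * (kernel k θ s).eval x ^ 2 * this
    · intro x hx
      have hx2 : x ^ 2 ≤ θ ^ 2 := by rw [← sq_abs x]; gcongr
      simp only [eval_mul, hP]
      nlinarith [mul_nonneg (sub_nonneg.mpr hx2) (sq_nonneg (K.eval x))]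
  -- The F_{s+2} part of P contributes a nonnegative trace; the G_s part gives the order times K(k).
  have hlower : d * (Fintype.card V * K.eval (k : ℝ)) ≤
      (aeval (Γ.adjMatrix ℝ) (P * K)).trace := by
    rw [show P * K = C g * (F k (s + 2) * K) + C d * (G k (s + 2 * 0) * K) by simp [P]; ring,
      map_add, map_mul, map_mul (aeval _) (C d), aeval_C, aeval_C, ← Algebra.smul_def,
      ← Algebra.smul_def, Matrix.trace_add, Matrix.trace_smul, Matrix.trace_smul]
    have h1 := mul_nonneg hg.le (trace_aeval_F_mul_kernel_nonneg hΓ (s + 2) s hpos)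
    have h2 := mul_le_mul_of_nonneg_left (le_trace_aeval_G_mul_kernel hΓ s 0 hpos) hd0
    simp only [smul_eq_mul]
    linarith
  have hK := kernel_eval_degree_pos hk hθ0 s hpos
  have := hlower.trans hupper
  rw [eval_mul] at this
  have hPk : P.eval (k : ℝ) = g * (F k (s + 2)).eval (k : ℝ) + d * (G k s).eval (k : ℝ) := by
    simp [P]
  rw [← hPk]
  refine le_of_mul_le_mul_right ?_ hK
  calc _ = d * (Fintype.card V * K.eval (k : ℝ)) := by ring
    _ ≤ _ := this
    _ = _ := by ring

/-- With 2k vertices the trace of A² is 2k², which the eigenvalues k and -k already exhaust, so all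
others vanish. -/
lemma card_filter_pos_roots_charpoly_le [Nonempty V] (hb : Γ.IsBipartite)
    (hΓ : Γ.IsRegularOfDegree k) (hk : 0 < k) (hV : Fintype.card V = 2 * k) :
    ((Γ.adjMatrix ℝ).charpoly.roots.filter fun x => 0 < x).card ≤ 1 := by
  set E := (Γ.adjMatrix ℝ).charpoly.roots with hE
  have hk' : (0 : ℝ) < k := by exact_mod_cast hk
  have hkE : (k : ℝ) ∈ E := degree_mem_roots_charpoly hΓ
  have hkE' : -(k : ℝ) ∈ E := by
    rw [hE, ← map_neg_roots_charpoly hb]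
    exact Multiset.mem_map_of_mem _ hkE
  obtain ⟨E1, h1⟩ := Multiset.exists_cons_of_mem hkE
  rw [h1, Multiset.mem_cons] at hkE'
  obtain ⟨E2, h2⟩ := Multiset.exists_cons_of_mem (hkE'.resolve_left (by linarith))
  have hsq : (E.map fun x => x ^ 2).sum = 2 * (k : ℝ) ^ 2 := by
    have h := trace_aeval (Γ.isHermitian_adjMatrix ℝ) (X ^ 2 : ℝ[X])
    simp only [eval_pow, eval_X] at h
    rw [hE, ← h, map_pow, aeval_X, sq, Matrix.trace]
    simp only [Matrix.diag_apply, SimpleGraph.adjMatrix_mul_self_apply_self, hΓ.degree_eq]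
    simp [hV]
    ring
  rw [h1, h2] at hsq
  simp only [Multiset.map_cons, Multiset.sum_cons] at hsq
  have hzero : ∀ x ∈ E2, x = 0 := by
    intro x hx
    have := Multiset.single_le_sum (s := E2.map fun x => x ^ 2)
      (fun y hy => by obtain ⟨z, _, rfl⟩ := Multiset.mem_map.mp hy; positivity)
      (x ^ 2) (Multiset.mem_map_of_mem _ hx)
    nlinarith
  rw [h1, h2, Multiset.filter_cons_of_pos _ hk', Multiset.filter_cons_of_neg _ (by linarith),
    Multiset.filter_eq_nil.mpr fun x hx => by rw [hzero x hx]; exact lt_irrefl _]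
  simp

end Graphs

/-! ### The set of orders: a member and an upper bound -/

lemma secondEigenvalue_le_iff {V : Type*} [Fintype V] [DecidableEq V] (Γ : SimpleGraph V)
    [DecidableRel Γ.Adj] (hV : 1 < Fintype.card V) (θ : ℝ) :
    secondEigenvalue Γ hV ≤ θ ↔
      ((Γ.adjMatrix ℝ).charpoly.roots.filter fun x => θ < x).card ≤ 1 := by
  refine (@eigenvalues₀_one_le_iff V _ (fun a b => Classical.propDecidable (a = b)) _ _ hV θ).trans ?_
  congr!

/-- The witness is K_{k,k}, transported to `Fin (k + k)`. It makes the set of orders nonempty, so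
that its supremum is attained once it is bounded. -/
lemma two_mul_mem_orders {k : ℕ} (hk : 2 ≤ k) {θ : ℝ} (hθ : 0 ≤ θ) : k + k ∈ orders k θ := by
  classical
  let B := completeBipartiteGraph (Fin k) (Fin k)
  let Γ : SimpleGraph (Fin (k + k)) := B.comap finSumFinEquiv.symm
  let e : Γ ≃g B := SimpleGraph.Iso.comap finSumFinEquiv.symm B
  have hV : 1 < Fintype.card (Fin (k + k)) := by rw [Fintype.card_fin]; omega
  have : Nonempty (Fin (k + k)) := ⟨⟨0, by omega⟩⟩
  have hB : B.IsRegularOfDegree k := by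
    rintro (v | v)
    · rw [← SimpleGraph.card_neighborFinset_eq_degree,
        show B.neighborFinset (Sum.inl v) = Finset.univ.map Function.Embedding.inr by
          ext (w | w) <;> simp [B]]
      simp
    · rw [← SimpleGraph.card_neighborFinset_eq_degree,
        show B.neighborFinset (Sum.inr v) = Finset.univ.map Function.Embedding.inl by
          ext (w | w) <;> simp [B]]
      simp
  have hΓ : Γ.IsRegularOfDegree k := fun v => (e.degree_eq v).symm.trans (hB _)
  have hb : Γ.IsBipartite := by
    have h : B.Colorable 2 := by
      simpa using (SimpleGraph.CompleteBipartiteGraph.bicoloring (Fin k) (Fin k)).colorable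
    exact h.of_hom e.toHom
  have hc : Γ.Connected := by
    rw [e.connected_iff]
    have h0 : 0 < k := by omega
    have hadj : ∀ v w, B.Adj (Sum.inl v) (Sum.inr w) := fun v w => by simp [B]
    refine (SimpleGraph.connected_iff_exists_forall_reachable B).mpr ⟨Sum.inl ⟨0, h0⟩, ?_⟩
    rintro (v | v)
    · exact (hadj _ ⟨0, h0⟩).reachable.trans (hadj v _).symm.reachable
    · exact (hadj _ v).reachable
  refine ⟨Γ, hV, hc, hb, hΓ, le_trans ?_ hθ⟩
  rw [secondEigenvalue_le_iff]
  exact card_filter_pos_roots_charpoly_le hb hΓ (by omega) (by rw [Fintype.card_fin]; ring)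

lemma le_M_of_mem_orders {k : ℕ} (hk : 2 ≤ k) {θ : ℝ} (hθ0 : 0 < θ) (hθk : θ < k) {s : ℕ}
    (hpos : ∀ m ≤ s, 0 < (G k m).eval θ) (hneg : (G k (s + 2)).eval θ ≤ 0) {n : ℕ}
    (hn : n ∈ orders k θ) : (n : ℝ) ≤ M k (s + 4) (cParam k (s + 4) θ) := by
  classical
  obtain ⟨Γ, hV, -, hb, hΓ, hle⟩ := hn
  have : Nonempty (Fin n) := Fintype.card_pos_iff.mp (by omega)
  rw [secondEigenvalue_le_iff] at hle
  have h := card_mul_sub_le hb (fun v => by convert hΓ v) hk hθ0 hθk hle hpos hneg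
  have hg := hpos s le_rfl
  have hF : -(F k (s + 2)).eval θ = (G k s).eval θ - (G k (s + 2)).eval θ := by
    rw [G_add_two, eval_add]; ring
  rw [Fintype.card_fin, F_eval_degree, G_eval_degree, ← hF] at h
  have hF0 : 0 < -(F k (s + 2)).eval θ := by rw [hF]; linarith
  simp only [M, cParam, Nat.add_sub_cancel, show s + 4 - 3 = s + 1 by omega,
    show s + 4 - 2 = s + 2 by omega]
  refine le_of_mul_le_mul_right (h.trans_eq ?_) hF0
  -- What remains is algebra with c = d / G_s(θ); the two terms over c come from F_{s+2}(k) =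
  -- k(k-1)^{s+1} = (k-1)^{s+1} + (k-1)^{s+2}.
  generalize -(F k (s + 2)).eval θ = d at hF0
  field_simp
  ring

end BipReg

open BipReg in
theorem mainTheorem4 (k : ℕ) (hk : 2 ≤ k) :
    (∀ j : ℕ, 1 ≤ j → IsGreatest {x : ℝ | (BipReg.G k j).eval x = 0} (BipReg.lam k j)) ∧
    (⋃ j ∈ Set.Ici (1 : ℕ), Set.Ioc (BipReg.lam k j) (BipReg.lam k (j + 1))) =
      Set.Ioo (0 : ℝ) (2 * Real.sqrt ((k : ℝ) - 1)) ∧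
    ∀ (t : ℕ) (θ : ℝ), 4 ≤ t →
      BipReg.lam k (t - 3) < θ → θ ≤ BipReg.lam k (t - 2) →
        (BipReg.G k (t - 4)).eval θ ≠ 0 ∧
        0 < BipReg.cParam k t θ ∧
        IsGreatest (BipReg.orders k θ) (BipReg.b k θ) ∧
        (BipReg.b k θ : ℝ) ≤ BipReg.M k t (BipReg.cParam k t θ) := by
  refine ⟨fun j hj => lam_eq hk hj ▸ isGreatest_zeros hk hj, iUnion_Ioc_lam hk, ?_⟩
  intro t θ ht h1 h2
  obtain ⟨s, rfl⟩ := Nat.exists_eq_add_of_le' ht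
  rw [show s + 4 - 3 = s + 1 by omega] at h1
  rw [show s + 4 - 2 = s + 1 + 1 by omega] at h2
  have hpos : ∀ m ≤ s, 0 < (G k m).eval θ := fun m hm =>
    G_eval_pos_of_lam_lt hk (by omega) h1
  have hneg : (G k (s + 2)).eval θ ≤ 0 := G_eval_nonpos hk (by omega) h1 h2
  have hθ0 : 0 < θ := (lam_nonneg hk (by omega)).trans_lt h1
  have hθk : θ < k := by
    refine (h2.trans_lt (lam_lt hk (by omega))).trans_le ?_
    -- 2√(k-1) ≤ k is (√(k-1) - 1)² ≥ 0.
    nlinarith [Real.sq_sqrt (show (0 : ℝ) ≤ (k : ℝ) - 1 by linarith [one_le_sub_one hk]),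
      sq_nonneg (√((k : ℝ) - 1) - 1)]
  have hM : ∀ n ∈ orders k θ, (n : ℝ) ≤ M k (s + 4) (cParam k (s + 4) θ) := fun n hn =>
    le_M_of_mem_orders hk hθ0 hθk hpos hneg hn
  have hbdd : BddAbove (orders k θ) := ⟨_, fun n hn => Nat.le_floor (hM n hn)⟩
  have hmem : b k θ ∈ orders k θ := Nat.sSup_mem ⟨_, two_mul_mem_orders hk hθ0.le⟩ hbdd
  refine ⟨(hpos s le_rfl).ne', ?_, ⟨hmem, fun n hn => le_csSup hbdd hn⟩, hM _ hmem⟩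
  refine div_pos ?_ (hpos s le_rfl)
  have := hpos s le_rfl
  -- F_{s+2}(θ) + G_s(θ) ≤ 0 with G_s(θ) > 0 forces F_{s+2}(θ) < 0.
  rw [G_add_two, eval_add] at hneg
  rw [show s + 4 - 2 = s + 2 by omega]
  linarith
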